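/- Let $\varphi:\{a,b\}^*\to\{a,b\}^*$ be a non-primitive morphism (i.e. no power of the matrix counting the occurrences of letters in $\varphi(a)$ and $\varphi(b)$ has only positive entries) with $\varphi(a)\neq a$, and let $w=w[0]w[1]\cdots$ be an infinite word with $\varphi(w)=w$ which starts with $a$ and in which both letters appear. Let $L_w$ be the closure of the orbit of $w$ under the shift $\sigma$. (1) If $(L_w,\sigma)$ is minimal and $w$ is aperiodic (i.e. not ultimately periodic), then $\varphi(b)=b$ and $\varphi(a)=axa$ for some finite word $x$ containing $b$. (2) Whenever $\varphi(b)=b$ and $\varphi(a)=axa$ for some finite word $x$ containing $b$, the subshift $(L_w,\sigma)$ is minimal and uniquely ergodic (there is exactly one $\sigma$-invariant Borel probability measure on $L_w$), and the limit $$\lim_{u\in \mathrm{Fac}(w),\ |u|\to\infty}\frac{|\varphi(u)|}{|u|}=\theta$$ exists in $\mathbb R$, where $\mathrm{Fac}(w)$ is the set of finite factors of $w$. -/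

import Mathlib

namespace BinaryMorphism

/-- Infinite words over the alphabet `A`; with `A = Fin 2` they carry the product topology and the
product (Borel) σ-algebra. -/
abbrev InfWord (A : Type*) : Type _ := ℕ → A

/-- The shift map, erasing the first symbol. -/
def shift {A : Type*} (w : InfWord A) : InfWord A := fun n => w (n + 1)

/-- The factor `w[i] w[i+1] ⋯ w[i+n-1]` of length `n` of an infinite word. -/
def factor {A : Type*} (w : InfWord A) (i n : ℕ) : FreeMonoid A :=
  FreeMonoid.ofList ((List.range n).map fun k => w (i + k))

/-- The set of finite factors of an infinite word. -/
def Fac {A : Type*} (w : InfWord A) : Set (FreeMonoid A) :=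
  {u | ∃ i n, u = factor w i n}

/-- `v = φ(w)`: the images of the prefixes of `w` are prefixes of `v`, and their lengths are
unbounded (so that the possibly erasing morphism `φ` does map `w` to an infinite word). -/
def IsImage {A : Type*} (φ : FreeMonoid A →* FreeMonoid A) (w v : InfWord A) : Prop :=
  (∀ n, φ (factor w 0 n) = factor v 0 (φ (factor w 0 n)).length) ∧
    ∀ N, ∃ n, N ≤ (φ (factor w 0 n)).length

/-- The infinite word `w` is a fixed point of `φ`. -/
def IsFixedPoint {A : Type*} (φ : FreeMonoid A →* FreeMonoid A) (w : InfWord A) : Prop :=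
  IsImage φ w w

/-- The matrix of a morphism: the entry `(i, j)` counts the occurrences of `i` in `φ(j)`. -/
def incidenceMatrix {A : Type*} [DecidableEq A] (φ : FreeMonoid A →* FreeMonoid A) :
    Matrix A A ℤ :=
  Matrix.of fun i j => ((φ (FreeMonoid.of j)).toList.count i : ℤ)

/-- A morphism is primitive if some power of its matrix has only positive entries. -/
def IsPrimitive {A : Type*} [Fintype A] [DecidableEq A] (φ : FreeMonoid A →* FreeMonoid A) :
    Prop :=
  (incidenceMatrix φ).IsPrimitive

/-- The subshift generated by `w`: the closure of the orbit of `w` under the shift. -/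
def subshift {A : Type*} [TopologicalSpace A] (w : InfWord A) : Set (InfWord A) :=
  closure (Set.range fun n : ℕ => shift^[n] w)

/-- The subshift generated by `w` is minimal: it has no nonempty proper closed subset that is
mapped into itself by the shift. -/
def IsMinimal {A : Type*} [TopologicalSpace A] (w : InfWord A) : Prop :=
  ∀ Y : Set (InfWord A), Y ⊆ subshift w → IsClosed Y → Y.Nonempty → Set.MapsTo shift Y Y →
    Y = subshift w

/-- `w = u v v v ⋯` for finite words `u` and `v`, with `v` nonempty (of length `p`). -/
def UltimatelyPeriodic {A : Type*} (w : InfWord A) : Prop :=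
  ∃ N p : ℕ, 0 < p ∧ ∀ n, N ≤ n → w (n + p) = w n

/-- An infinite word is aperiodic if it is not ultimately periodic. -/
def Aperiodic {A : Type*} (w : InfWord A) : Prop := ¬ UltimatelyPeriodic w

/-- There is a unique shift-invariant Borel probability measure on the subshift generated by `w`
(a measure on the subshift is a measure on all infinite words for which the complement of the
subshift is a null set). -/
def UniquelyErgodic {A : Type*} [TopologicalSpace A] [MeasurableSpace A] (w : InfWord A) : Prop :=
  ∃! μ : MeasureTheory.Measure (InfWord A),
    MeasureTheory.IsProbabilityMeasure μ ∧ μ (subshift w)ᶜ = 0 ∧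
      MeasureTheory.MeasurePreserving shift μ μ

/-- `φ(b) = b` and `φ(a) = a x a` for a finite word `x` containing `b`. -/
def HasFormAXA {A : Type*} (φ : FreeMonoid A →* FreeMonoid A) (a b : A) : Prop :=
  φ (FreeMonoid.of b) = FreeMonoid.of b ∧
    ∃ x : FreeMonoid A, b ∈ x ∧
      φ (FreeMonoid.of a) = FreeMonoid.of a * x * FreeMonoid.of a

/-- `|φ(u)| / |u|` tends to `θ` as `|u| → ∞`, where `u` runs over the factors of `w`. -/
def LengthRatioTendsto {A : Type*} (φ : FreeMonoid A →* FreeMonoid A) (w : InfWord A) (θ : ℝ) :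
    Prop :=
  Filter.Tendsto (fun u : FreeMonoid A => ((φ u).length : ℝ) / (u.length : ℝ))
    (Filter.comap FreeMonoid.length Filter.atTop ⊓ Filter.principal (Fac w)) (nhds θ)

end BinaryMorphism

/-! For (1), arbitrarily long runs of `b` would put the constant word `b` in the subshift, and
minimality would force `w` to be that word, although `w 0 = a`. So runs of `b` are bounded.
Aperiodicity excludes erased letters, hence `φ(a) = ay` with `y` nonempty, and `b` occurs in `y`,
since otherwise `w` would be constant. Then `a` cannot occur in `φ(b)`, or the square of the matrix
would be positive. So `φ(b)` is a power of `b`; a higher power than the first, or a final `b` in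
`φ(a)`, would lengthen runs without bound (`exists_run_of_growing`, `exists_run_of_getLast`).

For (2), `w` is a sequence of letters `a` separated by runs of `b` of length at most `s = |x|`.
Applying `φ` lengthens the blocks but leaves the gaps unchanged, so `w` is made of copies of
arbitrarily long prefixes with gaps bounded by the same `s` (`exists_isBlockSet`). Thus prefixes
recur with bounded gaps, which gives minimality. Birkhoff sums over two copies of a long block
nearly agree and the gaps are negligible, so averages converge uniformly
(`exists_hasUniformAverage`). This gives unique ergodicity, and the limit `θ` on taking the function
`x ↦ |φ(x 0)|`. -/

namespace BinaryMorphism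

variable {A : Type*}

/-! ### Factors, and how the images of letters tile a fixed point. -/

section Factors

theorem factor_length (w : InfWord A) (i n : ℕ) : (factor w i n).length = n := by
  change ((List.range n).map fun k => w (i + k)).length = n
  simp

theorem factor_add (w : InfWord A) (i m n : ℕ) :
    factor w i (m + n) = factor w i m * factor w (i + m) n := by
  apply FreeMonoid.toList.injective
  simp [factor, List.range_add, Function.comp_def, add_assoc]

theorem factor_one (w : InfWord A) (i : ℕ) : factor w i 1 = FreeMonoid.of (w i) := by
  apply FreeMonoid.toList.injective
  simp [factor]

theorem getElem?_factor (w : InfWord A) (i : ℕ) {n t : ℕ} (ht : t < n) :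
    (factor w i n).toList[t]? = some (w (i + t)) := by
  simp [factor, ht]

theorem mem_factor {w : InfWord A} {i n : ℕ} {c : A} :
    c ∈ factor w i n ↔ ∃ t < n, w (i + t) = c := by
  change c ∈ (List.range n).map (fun k => w (i + k)) ↔ _
  simp

end Factors

/-- The length of the image of the prefix of length `n` of `w`. -/
def imagePos (φ : FreeMonoid A →* FreeMonoid A) (w : InfWord A) (n : ℕ) : ℕ :=
  (φ (factor w 0 n)).length

section FixedPoint

variable {φ : FreeMonoid A →* FreeMonoid A} {w : InfWord A}

theorem imagePos_zero (φ : FreeMonoid A →* FreeMonoid A) (w : InfWord A) : imagePos φ w 0 = 0 := by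
  have : factor w 0 0 = 1 := rfl
  simp [imagePos, this]

theorem imagePos_add (φ : FreeMonoid A →* FreeMonoid A) (w : InfWord A) (m n : ℕ) :
    imagePos φ w (m + n) = imagePos φ w m + (φ (factor w m n)).length := by
  simp [imagePos, factor_add, FreeMonoid.length_mul]

theorem imagePos_succ (φ : FreeMonoid A →* FreeMonoid A) (w : InfWord A) (n : ℕ) :
    imagePos φ w (n + 1) = imagePos φ w n + (φ (FreeMonoid.of (w n))).length := by
  rw [imagePos_add, factor_one]

theorem imagePos_mono (φ : FreeMonoid A →* FreeMonoid A) (w : InfWord A) :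
    Monotone (imagePos φ w) :=
  monotone_nat_of_le_succ fun n => by rw [imagePos_succ]; omega

theorem IsFixedPoint.map_factor (hw : IsFixedPoint φ w) (i n : ℕ) :
    φ (factor w i n) = factor w (imagePos φ w i) (φ (factor w i n)).length := by
  have h := hw.1 (i + n)
  have hl : (φ (factor w 0 (i + n))).length
      = imagePos φ w i + (φ (factor w i n)).length := imagePos_add φ w i n
  rw [hl, factor_add, map_mul, factor_add, zero_add, zero_add, hw.1 i] at h
  exact mul_left_cancel h

theorem IsFixedPoint.map_letter (hw : IsFixedPoint φ w) (n : ℕ) :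
    φ (FreeMonoid.of (w n)) = factor w (imagePos φ w n) (φ (FreeMonoid.of (w n))).length := by
  simpa only [factor_one] using hw.map_factor n 1

theorem IsFixedPoint.getElem?_map_letter (hw : IsFixedPoint φ w) (n : ℕ) {t : ℕ}
    (ht : t < (φ (FreeMonoid.of (w n))).length) :
    (φ (FreeMonoid.of (w n))).toList[t]? = some (w (imagePos φ w n + t)) := by
  rw [hw.map_letter n]
  exact getElem?_factor w _ ht

theorem IsFixedPoint.mem_map_letter (hw : IsFixedPoint φ w) (n : ℕ) {t : ℕ}
    (ht : t < (φ (FreeMonoid.of (w n))).length) :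
    w (imagePos φ w n + t) ∈ φ (FreeMonoid.of (w n)) := by
  rw [hw.map_letter n]
  exact mem_factor.2 ⟨t, ht, rfl⟩

/-- Every position of a fixed point lies in the image of some letter. -/
theorem IsFixedPoint.exists_imagePos (hw : IsFixedPoint φ w) (i : ℕ) :
    ∃ n t, t < (φ (FreeMonoid.of (w n))).length ∧ i = imagePos φ w n + t := by
  classical
  have hex : ∃ n, i < imagePos φ w n := (hw.2 (i + 1)).imp fun n hn => hn
  obtain ⟨n, hn⟩ : ∃ n, Nat.find hex = n + 1 := by
    refine Nat.exists_eq_succ_of_ne_zero fun h0 => ?_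
    have := Nat.find_spec hex
    rw [h0, imagePos_zero] at this
    omega
  have h1 := Nat.find_spec hex
  have h2 : ¬ i < imagePos φ w n := Nat.find_min hex (by omega)
  rw [hn, imagePos_succ] at h1
  exact ⟨n, i - imagePos φ w n, by omega, by omega⟩

theorem imagePos_add_of_run {b : A} (hb : φ (FreeMonoid.of b) = FreeMonoid.of b) {n k : ℕ}
    (h : ∀ t < k, w (n + t) = b) {t : ℕ} (ht : t ≤ k) :
    imagePos φ w (n + t) = imagePos φ w n + t := by
  induction t with
  | zero => rfl
  | succ t ih =>
    rw [← add_assoc, imagePos_succ, ih (by omega), h t (by omega), hb, FreeMonoid.length_of,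
      add_assoc]

theorem IsFixedPoint.apply_imagePos_of_fixed (hw : IsFixedPoint φ w) {b : A}
    (hb : φ (FreeMonoid.of b) = FreeMonoid.of b) {n : ℕ} (hn : w n = b) :
    w (imagePos φ w n) = b := by
  have := hw.mem_map_letter n (t := 0) (by rw [hn, hb]; simp)
  rw [hn, hb] at this
  simpa using this

theorem IsFixedPoint.run_imagePos (hw : IsFixedPoint φ w) {b : A}
    (hb : φ (FreeMonoid.of b) = FreeMonoid.of b) {n k : ℕ} (h : ∀ t < k, w (n + t) = b) :
    ∀ t < k, w (imagePos φ w n + t) = b := by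
  intro t ht
  rw [← imagePos_add_of_run hb h ht.le]
  exact hw.apply_imagePos_of_fixed hb (h t ht)

end FixedPoint

/-! ### Erased letters, positivity of the matrix and growing runs of `b`. -/

section Binary

variable {φ : FreeMonoid (Fin 2) →* FreeMonoid (Fin 2)} {w : InfWord (Fin 2)} {a b : Fin 2}

theorem eq_or_eq_of_ne (hab : a ≠ b) (c : Fin 2) : c = a ∨ c = b := by omega

/-- A fixed point of a morphism erasing one of the two letters is periodic. -/
theorem IsFixedPoint.ultimatelyPeriodic_of_erasing (hw : IsFixedPoint φ w) (hab : a ≠ b)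
    (ha : φ (FreeMonoid.of a) = 1) : UltimatelyPeriodic w := by
  set p := (φ (FreeMonoid.of b)).length with hp
  -- Letter images have length `0` or `p`, so `w` is the infinite power of `φ(b)`.
  have hdvd : ∀ n, p ∣ imagePos φ w n := by
    intro n
    induction n with
    | zero => simp [imagePos_zero]
    | succ n ih =>
      rw [imagePos_succ]
      rcases eq_or_eq_of_ne hab (w n) with h | h
      · simpa [h, ha] using ih
      · rw [h]; exact dvd_add ih (dvd_refl _)
  have key : ∀ i, 0 < p ∧ (φ (FreeMonoid.of b)).toList[i % p]? = some (w i) := by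
    intro i
    obtain ⟨n, t, ht, rfl⟩ := hw.exists_imagePos i
    have hn : w n = b := by
      rcases eq_or_eq_of_ne hab (w n) with h | h
      · simp [h, ha] at ht
      · exact h
    have := hw.getElem?_map_letter n ht
    rw [hn, ← hp] at ht
    obtain ⟨k, hk⟩ := hdvd n
    rw [hn] at this
    refine ⟨by omega, ?_⟩
    rw [← this, hk, Nat.mul_add_mod, Nat.mod_eq_of_lt ht]
  refine ⟨0, p, (key 0).1, fun n _ => ?_⟩
  have h1 := (key (n + p)).2
  have h2 := (key n).2
  rw [Nat.add_mod_right, h2] at h1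
  exact (Option.some.inj h1).symm

theorem length_pos_of_ne_one {u : FreeMonoid A} (hu : u ≠ 1) : 0 < u.length :=
  Nat.pos_of_ne_zero fun h => hu (FreeMonoid.length_eq_zero.1 h)

/-- If the image of the first letter `a` of a fixed point has length at least two, then the other
letter occurs in this image, provided that it occurs in the fixed point and is not erased. -/
theorem IsFixedPoint.mem_map_of_mem (hw : IsFixedPoint φ w) (hab : a ≠ b) (hwa : w 0 = a)
    (hwb : ∃ n, w n = b) (hb1 : φ (FreeMonoid.of b) ≠ 1)
    (hla : 2 ≤ (φ (FreeMonoid.of a)).length) : b ∈ φ (FreeMonoid.of a) := by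
  by_contra hb
  -- Past the image of `w 0`, every position comes from a strictly earlier letter; if `φ(a)` had no
  -- `b`, induction would give only `a`.
  have hpos : ∀ n, n + 2 ≤ imagePos φ w (n + 1) := by
    intro n
    induction n with
    | zero => rw [imagePos_succ, imagePos_zero, hwa]; omega
    | succ n ih =>
      rw [imagePos_succ]
      rcases eq_or_eq_of_ne hab (w (n + 1)) with h | h <;> rw [h]
      · omega
      · have := length_pos_of_ne_one hb1
        omega
  have hall : ∀ i, w i = a := by
    intro i
    induction i using Nat.strong_induction_on with
    | _ i ih =>
      obtain ⟨n, t, ht, hi⟩ := hw.exists_imagePos i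
      have hn : w n = a := by
        rcases n with _ | n
        · exact hwa
        · exact ih _ (by have := hpos n; omega)
      have hm := hw.mem_map_letter n ht
      rw [← hi, hn] at hm
      rcases eq_or_eq_of_ne hab (w i) with h | h
      · exact h
      · exact absurd (h ▸ hm) hb
  obtain ⟨n, hn⟩ := hwb
  exact hab ((hall n).symm.trans hn)

/-- Only the `(b, b)` entry may vanish, and in the square it is at least the product of the two
off-diagonal entries. -/
theorem isPrimitive_of_mem (hab : a ≠ b) (haa : a ∈ φ (FreeMonoid.of a))
    (hba : b ∈ φ (FreeMonoid.of a)) (hbb : a ∈ φ (FreeMonoid.of b)) : IsPrimitive φ := by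
  have hn : ∀ i j, 0 ≤ incidenceMatrix φ i j := fun i j => by simp [incidenceMatrix]
  have hp : ∀ {i j}, i ∈ φ (FreeMonoid.of j) → 0 < incidenceMatrix φ i j := by
    intro i j h
    simp only [incidenceMatrix, Matrix.of_apply, Nat.cast_pos]
    exact List.count_pos_iff.2 h
  have h1 := hp haa
  have h2 := hp hba
  have h3 := hp hbb
  have h4 := hn b b
  refine ⟨hn, 2, by norm_num, ?_⟩
  have hsum : ∀ i j, (incidenceMatrix φ ^ 2) i j =
      incidenceMatrix φ i a * incidenceMatrix φ a j +
      incidenceMatrix φ i b * incidenceMatrix φ b j := by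
    intro i j
    have huniv : (Finset.univ : Finset (Fin 2)) = {a, b} := by
      ext c
      simpa using eq_or_eq_of_ne hab c
    rw [pow_two, Matrix.mul_apply, huniv, Finset.sum_pair hab]
  intro i j
  rw [hsum]
  rcases eq_or_eq_of_ne hab i with rfl | rfl <;> rcases eq_or_eq_of_ne hab j with rfl | rfl <;>
    positivity

/-- The last occurrence of `a` before a given position. -/
theorem exists_last_letter (hab : a ≠ b) (hwa : w 0 = a) (j : ℕ) :
    ∃ i ≤ j, w i = a ∧ ∀ k, i < k → k ≤ j → w k = b := by
  induction j with
  | zero => exact ⟨0, le_rfl, hwa, fun k h1 h2 => by omega⟩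
  | succ j ih =>
    rcases eq_or_eq_of_ne hab (w (j + 1)) with h | h
    · exact ⟨j + 1, le_rfl, h, fun k h1 h2 => by omega⟩
    · obtain ⟨i, hi, hia, hk⟩ := ih
      refine ⟨i, by omega, hia, fun k h1 h2 => ?_⟩
      rcases Nat.lt_or_ge k (j + 1) with h3 | h3
      · exact hk k h1 (by omega)
      · rwa [show k = j + 1 by omega]

theorem IsFixedPoint.exists_run_of_growing (hw : IsFixedPoint φ w) (hab : a ≠ b)
    (hwb : ∃ n, w n = b) (hba : a ∉ φ (FreeMonoid.of b))
    (hlb : 2 ≤ (φ (FreeMonoid.of b)).length) (N : ℕ) : ∃ i, ∀ t < N, w (i + t) = b := by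
  -- A run of length `N` has an image of length at least `2 * N`, which exceeds `N` only for `N ≥
  -- 1`.
  rcases Nat.eq_zero_or_pos N with rfl | hN
  · exact ⟨0, fun t ht => by omega⟩
  induction N, hN using Nat.le_induction with
  | base =>
    obtain ⟨n, hn⟩ := hwb
    exact ⟨n, fun t ht => by rwa [show t = 0 by omega]⟩
  | succ N hN ih =>
    obtain ⟨i, hi⟩ := ih
    have hlen : ∀ t ≤ N, imagePos φ w i + 2 * t ≤ imagePos φ w (i + t) := by
      intro t ht
      induction t with
      | zero => simp
      | succ t ih =>
        have := ih (by omega)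
        rw [← add_assoc, imagePos_succ, hi t (by omega)]
        omega
    refine ⟨imagePos φ w i, fun t ht => ?_⟩
    obtain ⟨n, s, hs, hns⟩ := hw.exists_imagePos (imagePos φ w i + t)
    have h1 : n < i + N := by
      by_contra h
      have := imagePos_mono φ w (not_lt.1 h)
      have := hlen N le_rfl
      omega
    have h2 : i ≤ n := by
      by_contra h
      have := imagePos_mono φ w (show n + 1 ≤ i by omega)
      rw [imagePos_succ] at this
      omega
    have hn : w n = b := by simpa [show i + (n - i) = n by omega] using hi (n - i) (by omega)
    have hm := hw.mem_map_letter n hs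
    rw [← hns, hn] at hm
    exact (eq_or_eq_of_ne hab _).resolve_left fun h => hba (h ▸ hm)

/-- Extend a run back to the preceding `a`: the image of that `a` ends in `b` and is followed by the
unchanged run, now one letter longer. The condition `0 < i` leaves a position before the run in
which to look for this `a`. -/
theorem IsFixedPoint.exists_run_of_getLast (hw : IsFixedPoint φ w) (hab : a ≠ b) (hwa : w 0 = a)
    (hb : φ (FreeMonoid.of b) = FreeMonoid.of b) {u : FreeMonoid (Fin 2)} (hu : u ≠ 1)
    (ha : φ (FreeMonoid.of a) = u * FreeMonoid.of b) (N : ℕ) :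
    ∃ i, 0 < i ∧ ∀ t < N, w (i + t) = b := by
  have hul := length_pos_of_ne_one hu
  induction N with
  | zero => exact ⟨1, one_pos, fun t ht => by omega⟩
  | succ N ih =>
    obtain ⟨j, hj, hrun⟩ := ih
    obtain ⟨i, hij, hia, hlast⟩ := exists_last_letter hab hwa (j - 1)
    have hl : (φ (FreeMonoid.of (w i))).length = u.length + 1 := by
      rw [hia, ha, FreeMonoid.length_mul, FreeMonoid.length_of]
    have hsucc := imagePos_succ φ w i
    have hend : w (imagePos φ w i + u.length) = b := by
      have h := hw.getElem?_map_letter i (t := u.length) (by omega)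
      rw [hia, ha] at h
      simpa [FreeMonoid.toList_mul, FreeMonoid.length] using h.symm
    have hrun' : ∀ t < N, w (i + 1 + t) = b := by
      intro t ht
      rcases Nat.lt_or_ge (i + 1 + t) j with h | h
      · exact hlast _ (by omega) (by omega)
      · simpa [show j + (i + 1 + t - j) = i + 1 + t by omega] using
          hrun (i + 1 + t - j) (by omega)
    refine ⟨imagePos φ w i + u.length, by omega, fun t ht => ?_⟩
    rcases t with _ | t
    · exact hend
    · have := hw.run_imagePos hb hrun' t (by omega)
      rw [hsucc, hl] at this
      rw [← this]
      congr 1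
      omega

end Binary

/-! ### Block decompositions with bounded gaps. -/

/-- `P` is a set of positions of blocks in `w`: each block is a copy of the prefix of length `l` of
`w`, and is followed by a gap of length at most `s`, filled with the letter `b`, and another
block. -/
structure IsBlockSet (w : InfWord A) (b : A) (s l : ℕ) (P : Set ℕ) : Prop where
  zero_mem : 0 ∈ P
  apply_add : ∀ n ∈ P, ∀ t < l, w (n + t) = w t
  exists_next : ∀ n ∈ P, ∃ g ≤ s, n + l + g ∈ P ∧ ∀ t < g, w (n + l + t) = b

theorem factor_congr {w : InfWord A} {i j n : ℕ} (h : ∀ t < n, w (i + t) = w (j + t)) :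
    factor w i n = factor w j n := by
  apply FreeMonoid.toList.injective
  simp only [factor, FreeMonoid.toList_ofList]
  exact List.map_congr_left fun t ht => h t (List.mem_range.1 ht)

/-- The gaps consist of the fixed letter `b`, so `φ` does not stretch them and `s` is preserved. -/
theorem IsBlockSet.image {φ : FreeMonoid A →* FreeMonoid A} {w : InfWord A} {b : A} {s l : ℕ}
    {P : Set ℕ} (hw : IsFixedPoint φ w) (hb : φ (FreeMonoid.of b) = FreeMonoid.of b)
    (hP : IsBlockSet w b s l P) :
    IsBlockSet w b s (imagePos φ w l) (imagePos φ w '' P) := by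
  have hfac : ∀ n ∈ P, factor w n l = factor w 0 l := fun n hn =>
    factor_congr fun t ht => by rw [zero_add]; exact hP.apply_add n hn t ht
  have hadd : ∀ n ∈ P, imagePos φ w (n + l) = imagePos φ w n + imagePos φ w l := fun n hn => by
    rw [imagePos_add, hfac n hn]; rfl
  refine ⟨⟨0, hP.zero_mem, imagePos_zero φ w⟩, ?_, ?_⟩
  · rintro _ ⟨n, hn, rfl⟩ t ht
    have h1 := hw.map_factor n l
    have h2 := hw.map_factor 0 l
    rw [hfac n hn, h2, factor_length] at h1
    have h3 := congrArg (fun u => u.toList[t]?) h1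
    have ht' : t < (φ (factor w 0 l)).length := ht
    simp only [getElem?_factor w _ ht', imagePos_zero, zero_add] at h3
    exact (Option.some.inj h3).symm
  · rintro _ ⟨n, hn, rfl⟩
    obtain ⟨g, hg, hgP, hrun⟩ := hP.exists_next n hn
    refine ⟨g, hg, ⟨_, hgP, ?_⟩, ?_⟩
    · rw [imagePos_add_of_run hb hrun le_rfl, hadd n hn]
    · rw [← hadd n hn]
      exact hw.run_imagePos hb hrun

section AXA

variable {φ : FreeMonoid (Fin 2) →* FreeMonoid (Fin 2)} {w : InfWord (Fin 2)} {a b : Fin 2}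

/-- Each `a` lies in some copy of `φ(a) = axa`. Unless it is the final letter, the final `a` of that
copy follows within the bound. Otherwise the copy comes from an earlier `a`, whose following gap is
reproduced unchanged. -/
theorem IsFixedPoint.exists_next_letter (hw : IsFixedPoint φ w) (hab : a ≠ b)
    (hb : φ (FreeMonoid.of b) = FreeMonoid.of b) {x : FreeMonoid (Fin 2)}
    (ha : φ (FreeMonoid.of a) = FreeMonoid.of a * x * FreeMonoid.of a) (n : ℕ) (hn : w n = a) :
    ∃ g ≤ x.length, w (n + 1 + g) = a ∧ ∀ t < g, w (n + 1 + t) = b := by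
  have hmin : ∀ n, (∃ g ≤ x.length, w (n + 1 + g) = a) →
      ∃ g ≤ x.length, w (n + 1 + g) = a ∧ ∀ t < g, w (n + 1 + t) = b := by
    classical
    rintro n ⟨g, hg, hga⟩
    have hex : ∃ g, w (n + 1 + g) = a := ⟨g, hga⟩
    exact ⟨Nat.find hex, (Nat.find_min' hex hga).trans hg, Nat.find_spec hex, fun t ht =>
      (eq_or_eq_of_ne hab _).resolve_left (Nat.find_min hex ht)⟩
  apply hmin
  have hla : (φ (FreeMonoid.of a)).length = x.length + 2 := by
    rw [ha, FreeMonoid.length_mul, FreeMonoid.length_mul, FreeMonoid.length_of]; omega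
  have hpos : ∀ m, m ≤ imagePos φ w m := by
    intro m
    induction m with
    | zero => simp
    | succ m ih =>
      rw [imagePos_succ]
      rcases eq_or_eq_of_ne hab (w m) with h | h <;> rw [h]
      · omega
      · rw [hb, FreeMonoid.length_of]; omega
  have hfirst : ∀ m, w m = a → w (imagePos φ w m) = a := by
    intro m hm
    have h := hw.getElem?_map_letter m (t := 0) (by rw [hm]; omega)
    rw [hm, ha] at h
    simpa [FreeMonoid.toList_mul] using h.symm
  have hlast : ∀ m, w m = a → w (imagePos φ w m + (x.length + 1)) = a := by
    intro m hm
    have h := hw.getElem?_map_letter m (t := x.length + 1) (by rw [hm]; omega)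
    rw [hm, ha] at h
    simpa [FreeMonoid.toList_mul, FreeMonoid.length] using h.symm
  induction n using Nat.strong_induction_on with
  | _ n ih =>
    obtain ⟨m, t, ht, hmt⟩ := hw.exists_imagePos n
    have hm : w m = a := by
      refine (eq_or_eq_of_ne hab _).resolve_right fun h => hab ?_
      have hmem := hw.mem_map_letter m ht
      rw [← hmt, hn, h, hb] at hmem
      simpa using hmem
    rw [hm, hla] at ht
    rcases Nat.lt_or_ge t (x.length + 1) with h | h
    · refine ⟨x.length - t, by omega, ?_⟩
      rw [← hlast m hm]
      congr 1
      omega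
    · obtain ⟨g, hg, hga, hrun⟩ := hmin m (ih m (by have := hpos m; omega) hm)
      have h1 := hfirst _ hga
      rw [imagePos_add_of_run hb hrun le_rfl, imagePos_succ, hm, hla] at h1
      refine ⟨g, hg, ?_⟩
      rw [← h1]
      congr 1
      omega

theorem IsFixedPoint.exists_isBlockSet (hw : IsFixedPoint φ w) (hab : a ≠ b) (hwa : w 0 = a)
    (h : HasFormAXA φ a b) : ∃ s, ∀ L, ∃ l ≥ L, ∃ P, IsBlockSet w b s l P := by
  obtain ⟨hb, x, -, ha⟩ := h
  have hstrict : ∀ l, 0 < l → l < imagePos φ w l := by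
    intro l hl
    induction l, hl using Nat.le_induction with
    | base =>
      rw [imagePos_succ, hwa, ha, FreeMonoid.length_mul, FreeMonoid.length_mul,
        FreeMonoid.length_of]
      omega
    | succ l hl ih =>
      rw [imagePos_succ]
      rcases eq_or_eq_of_ne hab (w l) with h | h <;> rw [h]
      · rw [ha, FreeMonoid.length_mul, FreeMonoid.length_of]; omega
      · rw [hb, FreeMonoid.length_of]; omega
  refine ⟨x.length, fun L => ?_⟩
  induction L with
  | zero =>
    refine ⟨1, by omega, {n | w n = a}, hwa, fun n hn t ht => ?_, fun n hn => ?_⟩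
    · rw [show t = 0 by omega, hwa]
      exact hn
    · exact hw.exists_next_letter hab hb ha n hn
  | succ L ih =>
    obtain ⟨l, hl, P, hP⟩ := ih
    -- The induction hypothesis allows `l = 0`, and empty blocks do not grow; restart from single
    -- letters.
    rcases Nat.eq_zero_or_pos l with rfl | hl0
    · refine ⟨1, by omega, {n | w n = a}, hwa, fun n hn t ht => ?_, fun n hn => ?_⟩
      · rw [show t = 0 by omega, hwa]
        exact hn
      · exact hw.exists_next_letter hab hb ha n hn
    · exact ⟨_, by have := hstrict l hl0; omega, _, hP.image hw hb⟩

end AXA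


open Filter Topology MeasureTheory

/-! ### The topology of the subshift. -/

section Topology

variable {A : Type*}

theorem iterate_shift_apply (w : InfWord A) (n i : ℕ) : shift^[n] w i = w (n + i) := by
  induction n generalizing w with
  | zero => simp
  | succ n ih =>
    rw [Function.iterate_succ_apply, ih, shift]
    congr 1
    omega

variable [TopologicalSpace A]

theorem continuous_shift : Continuous (shift : InfWord A → InfWord A) :=
  continuous_pi fun n => continuous_apply (n + 1)

theorem iterate_shift_mem_subshift (w : InfWord A) (n : ℕ) : shift^[n] w ∈ subshift w :=
  subset_closure ⟨n, rfl⟩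

theorem self_mem_subshift (w : InfWord A) : w ∈ subshift w :=
  iterate_shift_mem_subshift w 0

theorem isClosed_subshift (w : InfWord A) : IsClosed (subshift w) := isClosed_closure

theorem mem_closure_infWord_iff [DiscreteTopology A] {S : Set (InfWord A)} {x : InfWord A} :
    x ∈ closure S ↔ ∀ m, ∃ y ∈ S, ∀ i < m, y i = x i := by
  constructor
  · intro hx m
    obtain ⟨y, hy, hyS⟩ := mem_closure_iff.1 hx _ (PiNat.isOpen_cylinder (fun _ => A) x m)
      (PiNat.self_mem_cylinder x m)
    exact ⟨y, hyS, fun i hi => hy i hi⟩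
  · intro h
    choose y hyS hy using h
    refine mem_closure_of_tendsto (f := y) (b := atTop) (tendsto_pi_nhds.2 fun i => ?_)
      (Eventually.of_forall hyS)
    refine tendsto_const_nhds.congr' ?_
    filter_upwards [eventually_gt_atTop i] with m hm using (hy m i hm).symm

theorem mem_subshift_iff [DiscreteTopology A] {w x : InfWord A} :
    x ∈ subshift w ↔ ∀ m, ∃ j, ∀ i < m, w (j + i) = x i := by
  simp only [subshift, mem_closure_infWord_iff, Set.exists_range_iff, iterate_shift_apply]

/-- A minimal subshift containing a constant word consists of this word. -/
theorem IsMinimal.eq_of_forall_exists_run [DiscreteTopology A] {w : InfWord A} (h : IsMinimal w)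
    {b : A} (hrun : ∀ N, ∃ i, ∀ t < N, w (i + t) = b) (n : ℕ) : w n = b := by
  have hmem : (fun _ => b) ∈ subshift w := mem_subshift_iff.2 hrun
  have := h {fun _ => b} (Set.singleton_subset_iff.2 hmem) isClosed_singleton
    (Set.singleton_nonempty _) (fun x hx => by rw [Set.mem_singleton_iff.1 hx]; rfl)
  have hw := self_mem_subshift w
  rw [← this, Set.mem_singleton_iff] at hw
  rw [hw]

/-- A continuous function on infinite words is determined up to `ε` by a prefix of fixed length. -/
theorem exists_forall_dist_le [DiscreteTopology A] [Finite A] {f : InfWord A → ℝ}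
    (hf : Continuous f) {ε : ℝ} (hε : 0 < ε) :
    ∃ m : ℕ, ∀ x y : InfWord A, (∀ i < m, x i = y i) → |f x - f y| ≤ ε := by
  by_contra! hcon
  choose x y hxy hfar using hcon
  -- By compactness `x` converges along an ultrafilter; `y` agrees with it on ever longer prefixes
  -- and has the same limit.
  set z := ((hyperfilter ℕ).map x).lim
  have hx : Tendsto x (hyperfilter ℕ) (𝓝 z) := ((hyperfilter ℕ).map x).le_nhds_lim
  have hy : Tendsto y (hyperfilter ℕ) (𝓝 z) := by
    refine tendsto_pi_nhds.2 fun i => ((tendsto_pi_nhds.1 hx) i).congr' ?_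
    filter_upwards [Nat.hyperfilter_le_atTop (eventually_gt_atTop i)] with m hm using hxy m i hm
  have hlim : Tendsto (fun m => |f (x m) - f (y m)|) (hyperfilter ℕ) (𝓝 0) := by
    simpa using (((hf.tendsto z).comp hx).sub ((hf.tendsto z).comp hy)).abs
  obtain ⟨m, hm⟩ := (hlim.eventually_lt_const hε).exists
  exact (hfar m).not_gt hm

end Topology

/-! ### Minimality from blocks. -/

section Blocks

variable {A : Type*} {w : InfWord A} {b : A} {s l : ℕ} {P : Set ℕ}

theorem IsBlockSet.exists_mem_Icc (hP : IsBlockSet w b s l P) (hl : 0 < l) (j : ℕ) :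
    ∃ p ∈ P, j ≤ p ∧ p ≤ j + (l + s) := by
  induction j with
  | zero => exact ⟨0, hP.zero_mem, le_rfl, by omega⟩
  | succ j ih =>
    obtain ⟨p, hp, h1, h2⟩ := ih
    rcases Nat.lt_or_ge j p with h | h
    · exact ⟨p, hp, h, by omega⟩
    · obtain ⟨g, hg, hgP, -⟩ := hP.exists_next p hp
      exact ⟨_, hgP, by omega, by omega⟩

theorem isMinimal_of_isBlockSet [TopologicalSpace A] [DiscreteTopology A]
    (h : ∃ s, ∀ L, ∃ l ≥ L, ∃ P, IsBlockSet w b s l P) : IsMinimal w := by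
  obtain ⟨s, hs⟩ := h
  intro Y hYw hY ⟨y, hy⟩ hshift
  have hwY : w ∈ Y := by
    rw [← hY.closure_eq, mem_closure_infWord_iff]
    intro m
    obtain ⟨l, hl, P, hP⟩ := hs (m + 1)
    -- A block starts within `l + s` of any position, so a window of length `l + s + l` contains a
    -- whole block.
    obtain ⟨j, hj⟩ := mem_subshift_iff.1 (hYw hy) (l + s + l)
    obtain ⟨p, hp, h1, h2⟩ := hP.exists_mem_Icc (by omega) j
    refine ⟨shift^[p - j] y, hshift.iterate _ hy, fun i hi => ?_⟩
    rw [iterate_shift_apply, ← hj _ (by omega), ← hP.apply_add p hp i (by omega)]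
    congr 1
    omega
  refine hYw.antisymm (closure_minimal ?_ hY)
  rintro _ ⟨n, rfl⟩
  exact hshift.iterate n hwY

end Blocks

/-! ### Uniform convergence of Birkhoff averages. -/

section Averages

/-- If the increments of `E` between successive elements of a relatively dense set are small, then
all its increments are small. -/
theorem abs_sub_le_of_relatively_dense {E : ℕ → ℝ} {P : Set ℕ} {C ε : ℝ} {D : ℕ} (hε : 0 ≤ ε)
    (hE : ∀ k, |E (k + 1) - E k| ≤ C) (h0 : 0 ∈ P)
    (hP : ∀ n ∈ P, ∃ n' ∈ P, n < n' ∧ n' ≤ n + D ∧ |E n' - E n| ≤ ε * ((n' : ℝ) - n)) (j n : ℕ) :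
    |E (j + n) - E j| ≤ ε * n + (3 * C + ε) * D := by
  have hC : 0 ≤ C := (abs_nonneg _).trans (hE 0)
  have hlip : ∀ k d : ℕ, |E (k + d) - E k| ≤ C * d := by
    intro k d
    induction d with
    | zero => simp
    | succ d ih =>
      have h1 := hE (k + d)
      have h2 := abs_sub_le (E (k + d + 1)) (E (k + d)) (E k)
      rw [← add_assoc]
      push_cast
      linarith
  have hnext : ∀ p ∈ P, ∀ d : ℕ, ∃ p' ∈ P, p + d ≤ p' ∧ p' ≤ p + d + D ∧
      |E p' - E p| ≤ ε * ((p' : ℝ) - p) := by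
    intro p hp d
    induction d with
    | zero => exact ⟨p, hp, by omega, by omega, by simp⟩
    | succ d ih =>
      obtain ⟨p', hp', h1, h2, h3⟩ := ih
      rcases Nat.lt_or_ge (p + d) p' with h | h
      · exact ⟨p', hp', by omega, by omega, h3⟩
      · obtain ⟨q, hq, h4, h5, h6⟩ := hP p' hp'
        refine ⟨q, hq, by omega, by omega, ?_⟩
        have := abs_sub_le (E q) (E p') (E p)
        linarith
  -- Replacing `j` by `p` costs `C * D`, replacing `j + n` by `p'` costs `2 * C * D`, and `p' - p ≤
  -- n + D` accounts for `ε * D`.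
  obtain ⟨p, hp, h1, h2, -⟩ := hnext 0 h0 j
  obtain ⟨p', hp', h3, h4, h5⟩ := hnext p hp n
  have h6 := hlip j (p - j)
  have h7 := hlip (j + n) (p' - (j + n))
  rw [show j + (p - j) = p by omega] at h6
  rw [show j + n + (p' - (j + n)) = p' by omega, abs_sub_comm] at h7
  have hd1 : ((p - j : ℕ) : ℝ) ≤ D := by exact_mod_cast (show p - j ≤ D by omega)
  have hd2 : ((p' - (j + n) : ℕ) : ℝ) ≤ 2 * D := by
    exact_mod_cast (show p' - (j + n) ≤ 2 * D by omega)
  have hd3 : (p' : ℝ) - p ≤ n + D := by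
    rw [sub_le_iff_le_add]
    exact_mod_cast (show p' ≤ n + D + p by omega)
  have h8 := mul_le_mul_of_nonneg_left hd1 hC
  have h9 := mul_le_mul_of_nonneg_left hd2 hC
  have h10 := mul_le_mul_of_nonneg_left hd3 hε
  have h11 := abs_sub_le (E (j + n)) (E p') (E j)
  have h12 := abs_sub_le (E p') (E p) (E j)
  linarith

/-- Averages of `x` that are almost constant, up to any error, converge uniformly. -/
theorem exists_uniform_average {x : ℕ → ℝ}
    (h : ∀ ε > 0, ∃ c K : ℝ, ∀ j n : ℕ,
      |∑ i ∈ Finset.range n, x (j + i) - c * n| ≤ ε * n + K) :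
    ∃ c : ℝ, ∀ ε > 0, ∃ K : ℝ, ∀ j n : ℕ,
      |∑ i ∈ Finset.range n, x (j + i) - c * n| ≤ ε * n + K := by
  set S : ℕ → ℝ := fun n => (∑ i ∈ Finset.range n, x (0 + i)) / n with hS
  have hbound : ∀ {ε c K : ℝ}, (∀ j n : ℕ, |∑ i ∈ Finset.range n, x (j + i) - c * n| ≤ ε * n + K) →
      ∀ n : ℕ, 0 < n → |S n - c| ≤ ε + K / n := by
    intro ε c K hK n hn
    have hn' : (0 : ℝ) < n := Nat.cast_pos.2 hn
    have h1 : S n - c = (∑ i ∈ Finset.range n, x (0 + i) - c * n) / n := by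
      rw [hS]; field_simp
    have h2 : ε + K / n = (ε * n + K) / n := by field_simp
    rw [h1, h2, abs_div, abs_of_pos hn']
    exact div_le_div_of_nonneg_right (hK 0 n) hn'.le
  have hlim : ∀ ε K : ℝ, Tendsto (fun n : ℕ => ε + K / n) atTop (𝓝 ε) := fun ε K => by
    simpa using tendsto_const_nhds.add (tendsto_const_div_atTop_nhds_zero_nat K)
  have hcauchy : CauchySeq S := by
    rw [Metric.cauchySeq_iff']
    intro ε hε
    obtain ⟨c, K, hK⟩ := h (ε / 4) (by positivity)
    have hev : ∀ᶠ n : ℕ in atTop, |S n - c| < ε / 2 := by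
      filter_upwards [(hlim (ε / 4) K).eventually_lt_const (show ε / 4 < ε / 2 by linarith),
        eventually_gt_atTop 0] with n h1 h2 using (hbound hK n h2).trans_lt h1
    obtain ⟨N, hN⟩ := eventually_atTop.1 hev
    refine ⟨N, fun n hn => ?_⟩
    have h1 := hN n hn
    have h2 := hN N le_rfl
    have h3 := abs_sub_le (S n) c (S N)
    rw [abs_sub_comm c] at h3
    rw [Real.dist_eq]
    linarith
  obtain ⟨c, hc⟩ := cauchySeq_tendsto_of_complete hcauchy
  refine ⟨c, fun ε hε => ?_⟩
  obtain ⟨c', K, hK⟩ := h (ε / 2) (by positivity)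
  -- The constant `c'` depends on `ε`; the limit `c` of the prefix averages replaces it at a cost of
  -- `ε / 2`.
  have hcc : |c - c'| ≤ ε / 2 :=
    le_of_tendsto_of_tendsto (hc.sub_const c').abs (hlim (ε / 2) K)
      ((eventually_gt_atTop 0).mono fun n hn => hbound hK n hn)
  refine ⟨K, fun j n => ?_⟩
  have h1 := hK j n
  have h2 := abs_sub_le (∑ i ∈ Finset.range n, x (j + i)) (c' * n) (c * n)
  have h3 : |c' * n - c * n| = |c - c'| * n := by
    rw [← sub_mul, abs_mul, abs_sub_comm, Nat.abs_cast]
  have h4 := mul_le_mul_of_nonneg_right hcc (Nat.cast_nonneg (α := ℝ) n)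
  linarith

/-- The Birkhoff averages of `f` along the orbit of `w` converge uniformly. -/
def HasUniformAverage {A : Type*} (w : InfWord A) (f : InfWord A → ℝ) (c : ℝ) : Prop :=
  ∀ ε > 0, ∃ K : ℝ, ∀ j n : ℕ,
    |∑ i ∈ Finset.range n, f (shift^[j + i] w) - c * n| ≤ ε * n + K

theorem exists_hasUniformAverage {A : Type*} [TopologicalSpace A] [DiscreteTopology A] [Finite A]
    {w : InfWord A} {b : A} (h : ∃ s, ∀ L, ∃ l ≥ L, ∃ P, IsBlockSet w b s l P)
    {f : InfWord A → ℝ} (hf : Continuous f) : ∃ c, HasUniformAverage w f c := by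
  obtain ⟨s, hs⟩ := h
  obtain ⟨C, hC⟩ : ∃ C, ∀ x, |f x| ≤ C := by
    obtain ⟨C, hC⟩ := isCompact_univ.exists_bound_of_continuousOn hf.continuousOn
    exact ⟨C, fun x => hC x (Set.mem_univ x)⟩
  have hC0 : 0 ≤ C := (abs_nonneg _).trans (hC w)
  refine exists_uniform_average (x := fun i => f (shift^[i] w)) fun ε hε => ?_
  obtain ⟨m, hm⟩ := exists_forall_dist_le hf (half_pos hε)
  -- Per block, the last `m` positions, whose windows leave the block, and at most `s` gap letters
  -- are uncontrolled; `L` makes their cost at most `ε / 2 * l`.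
  obtain ⟨L, hL⟩ := exists_nat_ge (2 * C * (m + s) / (ε / 2))
  rw [div_le_iff₀ (half_pos hε)] at hL
  obtain ⟨l, hl, P, hP⟩ := hs (L + m + 1)
  set x : ℕ → ℝ := fun i => f (shift^[i] w) with hx
  have hxC : ∀ i, |x i| ≤ C := fun i => hC _
  have hl0 : (0 : ℝ) < l := Nat.cast_pos.2 (by omega)
  set c : ℝ := (∑ t ∈ Finset.range l, x t) / l with hc
  have hcl : ∑ t ∈ Finset.range l, x t = l * c := by rw [hc]; field_simp
  have hcC : |c| ≤ C := by
    rw [hc, abs_div, abs_of_pos hl0, div_le_iff₀ hl0]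
    refine (Finset.abs_sum_le_sum_abs _ _).trans ?_
    refine (Finset.sum_le_card_nsmul _ _ C fun i _ => hxC i).trans ?_
    rw [Finset.card_range, nsmul_eq_mul, mul_comm]
  have hdiff : ∀ i, |x i - c| ≤ 2 * C := fun i => by
    have := abs_sub (x i) c
    have := hxC i
    linarith
  set E : ℕ → ℝ := fun n => ∑ i ∈ Finset.range n, (x i - c) with hE
  have hEadd : ∀ j n, E (j + n) - E j = ∑ i ∈ Finset.range n, (x (j + i) - c) := fun j n => by
    rw [hE, sub_eq_iff_eq_add']
    exact Finset.sum_range_add _ j n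
  have hblock : ∀ n ∈ P, |∑ t ∈ Finset.range l, (x (n + t) - c)| ≤ ε / 2 * l + 2 * C * m := by
    intro n hn
    -- Since `c` is the average over the prefix block, `c` may be replaced by the terms of that
    -- block.
    have h1 : ∑ t ∈ Finset.range l, (x (n + t) - c)
        = ∑ t ∈ Finset.range ((l - m) + m), (x (n + t) - x t) := by
      rw [Nat.sub_add_cancel (by omega), Finset.sum_sub_distrib, Finset.sum_sub_distrib, hcl]
      simp
    have h2 : |∑ t ∈ Finset.range (l - m), (x (n + t) - x t)| ≤ ε / 2 * l := by
      refine (Finset.abs_sum_le_sum_abs _ _).trans ?_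
      refine (Finset.sum_le_card_nsmul _ _ (ε / 2) fun t ht => ?_).trans ?_
      · rw [Finset.mem_range] at ht
        refine hm _ _ fun i hi => ?_
        rw [iterate_shift_apply, iterate_shift_apply, add_assoc,
          hP.apply_add n hn (t + i) (by omega)]
      · rw [Finset.card_range, nsmul_eq_mul, mul_comm]
        have : ((l - m : ℕ) : ℝ) ≤ l := Nat.cast_le.2 (Nat.sub_le l m)
        gcongr
    have h3 : |∑ t ∈ Finset.range m, (x (n + (l - m + t)) - x (l - m + t))| ≤ 2 * C * m := by
      refine (Finset.abs_sum_le_sum_abs _ _).trans ?_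
      refine (Finset.sum_le_card_nsmul _ _ (2 * C) fun t ht => ?_).trans ?_
      · have := abs_sub (x (n + (l - m + t))) (x (l - m + t))
        have := hxC (n + (l - m + t))
        have := hxC (l - m + t)
        linarith
      · rw [Finset.card_range, nsmul_eq_mul, mul_comm]
    rw [h1, Finset.sum_range_add]
    exact (abs_add_le _ _).trans (add_le_add h2 h3)
  have hnext : ∀ n ∈ P, ∃ n' ∈ P, n < n' ∧ n' ≤ n + (l + s) ∧
      |E n' - E n| ≤ ε * ((n' : ℝ) - n) := by
    intro n hn
    obtain ⟨g, hg, hgP, -⟩ := hP.exists_next n hn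
    refine ⟨_, hgP, by omega, by omega, ?_⟩
    have h1 : |∑ t ∈ Finset.range g, (x (n + (l + t)) - c)| ≤ 2 * C * s := by
      refine (Finset.abs_sum_le_sum_abs _ _).trans ?_
      refine (Finset.sum_le_card_nsmul _ _ (2 * C) fun t _ => hdiff _).trans ?_
      rw [Finset.card_range, nsmul_eq_mul, mul_comm]
      have : (g : ℝ) ≤ s := Nat.cast_le.2 hg
      gcongr
    have h2 : (L : ℝ) ≤ l := Nat.cast_le.2 (by omega)
    have h3 : (L : ℝ) * (ε / 2) ≤ l * (ε / 2) := by gcongr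
    have h4 : 0 ≤ ε * g := by positivity
    rw [add_assoc, hEadd, Finset.sum_range_add]
    refine (abs_add_le _ _).trans ((add_le_add (hblock n hn) h1).trans ?_)
    push_cast
    linarith
  refine ⟨c, (3 * (2 * C) + ε) * (l + s : ℕ), fun j n => ?_⟩
  have := abs_sub_le_of_relatively_dense (E := E) hε.le
    (fun k => by rw [hEadd]; simpa using hdiff k) hP.zero_mem hnext j n
  rw [hEadd, Finset.sum_sub_distrib] at this
  simpa [mul_comm] using this

end Averages

/-! ### Invariant measures and unique ergodicity. -/

section Measure

/-- The uniform probability measure on the first `n + 1` points of the orbit of `w`. -/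
noncomputable def empiricalMeasure {A : Type*} [MeasurableSpace A] (w : InfWord A) (n : ℕ) : Measure (InfWord A) :=
  ((n + 1 : ℕ) : ENNReal)⁻¹ • ∑ i ∈ Finset.range (n + 1), Measure.dirac (shift^[i] w)

theorem empiricalMeasure_apply_of_forall_mem {A : Type*} [MeasurableSpace A] (w : InfWord A)
    (n : ℕ) {S : Set (InfWord A)} (hS : MeasurableSet S) (h : ∀ i, shift^[i] w ∈ S) : empiricalMeasure w n S = 1 := by
  simp only [empiricalMeasure, Measure.smul_apply, Measure.finsetSum_apply,
    Measure.dirac_apply' _ hS, Set.indicator_of_mem (h _), Pi.one_apply, Finset.sum_const,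
    Finset.card_range, nsmul_eq_mul, mul_one, smul_eq_mul]
  exact ENNReal.inv_mul_cancel (by simp) (ENNReal.natCast_ne_top _)

variable {A : Type*} [TopologicalSpace A]

/-- For fixed `n` the bound is a closed condition that holds along the orbit of `w`. -/
theorem HasUniformAverage.of_mem_subshift {w : InfWord A} {f : InfWord A → ℝ} {c : ℝ}
    (h : HasUniformAverage w f c) (hf : Continuous f) {ε : ℝ} (hε : 0 < ε) :
    ∃ K : ℝ, ∀ x ∈ subshift w, ∀ n : ℕ,
      |∑ i ∈ Finset.range n, f (shift^[i] x) - c * n| ≤ ε * n + K := by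
  obtain ⟨K, hK⟩ := h ε hε
  refine ⟨K, fun x hx n => ?_⟩
  have hcont : Continuous fun x : InfWord A =>
      |∑ i ∈ Finset.range n, f (shift^[i] x) - c * n| :=
    ((continuous_finsetSum _ fun i _ => hf.comp (continuous_shift.iterate i)).sub
      continuous_const).abs
  refine closure_minimal (t := {x | |∑ i ∈ Finset.range n, f (shift^[i] x) - c * n| ≤ ε * n + K})
    ?_ (isClosed_le hcont continuous_const) hx
  rintro _ ⟨j, rfl⟩
  simpa [← Function.iterate_add_apply, add_comm] using hK j n

variable [DiscreteTopology A] [Finite A] [MeasurableSpace A] [BorelSpace A]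

theorem integrable_of_continuous_infWord (μ : Measure (InfWord A)) [IsFiniteMeasure μ]
    {f : InfWord A → ℝ} (hf : Continuous f) : Integrable f μ :=
  (BoundedContinuousFunction.mkOfCompact ⟨f, hf⟩).integrable μ

/-- Integrating the Birkhoff bound, invariance gives `|∫ f - c| * n ≤ ε * n + K` for all `n`,
impossible for small `ε` unless `∫ f = c`. -/
theorem HasUniformAverage.integral_eq {w : InfWord A} {f : InfWord A → ℝ} {c : ℝ}
    (h : HasUniformAverage w f c) (hf : Continuous f) (μ : Measure (InfWord A))
    [IsProbabilityMeasure μ] (hμ : μ (subshift w)ᶜ = 0) (hinv : MeasurePreserving shift μ μ) :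
    ∫ x, f x ∂μ = c := by
  have hint : ∀ i, Integrable (fun x => f (shift^[i] x)) μ := fun i =>
    integrable_of_continuous_infWord μ (hf.comp (continuous_shift.iterate i))
  have hi : ∀ i, ∫ x, f (shift^[i] x) ∂μ = ∫ x, f x ∂μ := by
    intro i
    have hp := hinv.iterate i
    rw [← integral_map hp.measurable.aemeasurable
      (hf.aestronglyMeasurable), hp.map_eq]
  have key : ∀ ε > 0, ∃ K : ℝ, ∀ n : ℕ, |∫ x, f x ∂μ - c| * n ≤ ε * n + K := by
    intro ε hε
    obtain ⟨K, hK⟩ := h.of_mem_subshift hf hε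
    refine ⟨K, fun n => ?_⟩
    have h1 : ∫ x, (∑ i ∈ Finset.range n, f (shift^[i] x) - c * n) ∂μ
        = (∫ x, f x ∂μ - c) * n := by
      rw [integral_sub (integrable_finsetSum _ fun i _ => hint i) (integrable_const _),
        integral_finsetSum _ fun i _ => hint i]
      simp [hi]
      ring
    have h2 := norm_integral_le_of_norm_le_const (μ := μ) (C := ε * n + K)
      (f := fun x => ∑ i ∈ Finset.range n, f (shift^[i] x) - c * n)
      ((ae_iff.2 hμ : ∀ᵐ x ∂μ, x ∈ subshift w).mono fun x hx => hK x hx n)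
    rw [h1] at h2
    simpa [abs_mul] using h2
  by_contra hne
  have hpos : 0 < |∫ x, f x ∂μ - c| := abs_pos.2 (sub_ne_zero.2 hne)
  obtain ⟨K, hK⟩ := key _ (half_pos hpos)
  obtain ⟨n, hn⟩ := exists_nat_gt (K / (|∫ x, f x ∂μ - c| / 2))
  rw [div_lt_iff₀ (half_pos hpos)] at hn
  have := hK n
  linarith

instance (w : InfWord A) (n : ℕ) : IsProbabilityMeasure (empiricalMeasure w n) :=
  ⟨empiricalMeasure_apply_of_forall_mem w n MeasurableSet.univ fun _ => Set.mem_univ _⟩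

theorem integral_empiricalMeasure (w : InfWord A) (n : ℕ) {f : InfWord A → ℝ}
    (hf : Continuous f) : ∫ x, f x ∂(empiricalMeasure w n)
      = ((n + 1 : ℕ) : ℝ)⁻¹ * ∑ i ∈ Finset.range (n + 1), f (shift^[i] w) := by
  rw [empiricalMeasure, integral_smul_measure,
    integral_finsetSum_measure fun i _ => integrable_of_continuous_infWord _ hf]
  simp only [integral_dirac, ENNReal.toReal_inv, ENNReal.toReal_natCast, smul_eq_mul]

/-- The Krylov–Bogolyubov theorem for subshifts. -/
theorem exists_invariant_measure (w : InfWord A) : ∃ μ : Measure (InfWord A),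
    IsProbabilityMeasure μ ∧ μ (subshift w)ᶜ = 0 ∧ MeasurePreserving shift μ μ := by
  let ν : ℕ → ProbabilityMeasure (InfWord A) := fun n => ⟨empiricalMeasure w n, inferInstance⟩
  -- Probability measures on a compact space form a compact space, so an ultrafilter limit exists.
  set μ := ((hyperfilter ℕ).map ν).lim
  have hμ : Tendsto ν (hyperfilter ℕ) (𝓝 μ) := ((hyperfilter ℕ).map ν).le_nhds_lim
  refine ⟨μ, inferInstance, ?_, continuous_shift.measurable, ?_⟩
  · have h := ProbabilityMeasure.limsup_measure_closed_le_of_tendsto hμ (isClosed_subshift w)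
    have h1 : ∀ n, (ν n : Measure (InfWord A)) (subshift w) = 1 := fun n =>
      empiricalMeasure_apply_of_forall_mem w n (isClosed_subshift w).measurableSet
        (iterate_shift_mem_subshift w)
    simp only [h1, limsup_const] at h
    exact (prob_compl_eq_zero_iff (isClosed_subshift w).measurableSet).2 (le_antisymm prob_le_one h)
  · have : IsProbabilityMeasure ((μ : Measure (InfWord A)).map shift) :=
      Measure.isProbabilityMeasure_map continuous_shift.measurable.aemeasurable
    refine ext_of_forall_integral_eq_of_IsFiniteMeasure fun f => ?_
    rw [integral_map continuous_shift.measurable.aemeasurable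
      f.continuous.aestronglyMeasurable]
    rw [ProbabilityMeasure.tendsto_iff_forall_integral_tendsto] at hμ
    have h1 := hμ f
    have h2 := hμ (f.compContinuous ⟨shift, continuous_shift⟩)
    -- The defect of invariance telescopes to two boundary terms divided by `n + 1`.
    have hdiff : ∀ n : ℕ, (∫ x, f (shift x) ∂(ν n : Measure (InfWord A)))
        - ∫ x, f x ∂(ν n : Measure (InfWord A))
        = ((n + 1 : ℕ) : ℝ)⁻¹ * (f (shift^[n + 1] w) - f w) := by
      intro n
      refine (congrArg₂ _ (integral_empiricalMeasure w n (f.continuous.comp continuous_shift))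
        (integral_empiricalMeasure w n f.continuous)).trans ?_
      rw [← mul_sub, ← Finset.sum_sub_distrib]
      simp only [Function.comp_apply, ← Function.iterate_succ_apply']
      rw [Finset.sum_range_sub (fun i => f (shift^[i] w))]
      rfl
    have h3 : Tendsto (fun n : ℕ => ((n + 1 : ℕ) : ℝ)⁻¹ * (f (shift^[n + 1] w) - f w))
        atTop (𝓝 0) := by
      refine squeeze_zero_norm (a := fun n : ℕ => ((n + 1 : ℕ) : ℝ)⁻¹ * (2 * ‖f‖)) (fun n => ?_) ?_
      · rw [norm_mul, norm_inv, Real.norm_natCast]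
        gcongr
        exact f.dist_le_two_norm _ _
      · have h4 := (tendsto_inv_atTop_nhds_zero_nat (𝕜 := ℝ)).comp (tendsto_add_atTop_nat 1)
        simpa using h4.mul_const (2 * ‖f‖)
    have h5 := tendsto_nhds_unique (h2.sub h1)
      ((h3.mono_left Nat.hyperfilter_le_atTop).congr fun n => (hdiff n).symm)
    exact sub_eq_zero.1 h5

theorem uniquelyErgodic_of_hasUniformAverage {w : InfWord A}
    (h : ∀ f : InfWord A → ℝ, Continuous f → ∃ c, HasUniformAverage w f c) :
    UniquelyErgodic w := by
  obtain ⟨μ, hμp, hμ, hinv⟩ := exists_invariant_measure w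
  refine ⟨μ, ⟨hμp, hμ, hinv⟩, ?_⟩
  rintro ν ⟨hνp, hν, hinv'⟩
  refine ext_of_forall_integral_eq_of_IsFiniteMeasure fun f => ?_
  obtain ⟨c, hc⟩ := h f f.continuous
  rw [hc.integral_eq f.continuous ν hν hinv', hc.integral_eq f.continuous μ hμ hinv]

end Measure

/-! ### Length ratios as Birkhoff averages. -/

theorem length_map_factor {A : Type*} (φ : FreeMonoid A →* FreeMonoid A) (w : InfWord A)
    (j n : ℕ) : ((φ (factor w j n)).length : ℝ)
      = ∑ i ∈ Finset.range n, ((φ (FreeMonoid.of (shift^[j + i] w 0))).length : ℝ) := by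
  induction n with
  | zero =>
    have : factor w j 0 = 1 := rfl
    simp [this]
  | succ n ih =>
    rw [factor_add, factor_one, map_mul, FreeMonoid.length_mul, Finset.sum_range_succ, ← ih,
      iterate_shift_apply, add_zero]
    push_cast
    rfl

theorem HasUniformAverage.lengthRatioTendsto {A : Type*} {φ : FreeMonoid A →* FreeMonoid A}
    {w : InfWord A} {θ : ℝ}
    (h : HasUniformAverage w (fun x => ((φ (FreeMonoid.of (x 0))).length : ℝ)) θ) :
    LengthRatioTendsto φ w θ := by
  rw [LengthRatioTendsto, Metric.tendsto_nhds]
  intro ε hε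
  obtain ⟨K, hK⟩ := h (ε / 2) (half_pos hε)
  obtain ⟨N, hN⟩ := exists_nat_gt (K / (ε / 2))
  rw [div_lt_iff₀ (half_pos hε)] at hN
  rw [eventually_inf_principal]
  filter_upwards [tendsto_comap.eventually (eventually_ge_atTop (N + 1))]
  rintro _ hu ⟨j, n, rfl⟩
  rw [factor_length] at hu ⊢
  have hNn : (N : ℝ) + 1 ≤ n := by exact_mod_cast hu
  have hn : (0 : ℝ) < n := by have := Nat.cast_nonneg (α := ℝ) N; linarith
  have h1 := hK j n
  rw [← length_map_factor] at h1
  have h2 : ((φ (factor w j n)).length : ℝ) / n - θ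
      = ((φ (factor w j n)).length - θ * n) / n := by field_simp
  rw [Real.dist_eq, h2, abs_div, abs_of_pos hn, div_lt_iff₀ hn]
  have h3 : (N : ℝ) * (ε / 2) ≤ n * (ε / 2) := by
    gcongr
    linarith
  linarith

/-! ### The form of `φ` in the minimal aperiodic case. -/

section Main

variable {φ : FreeMonoid (Fin 2) →* FreeMonoid (Fin 2)} {w : InfWord (Fin 2)} {a b : Fin 2}

theorem IsFixedPoint.hasFormAXA (hw : IsFixedPoint φ w) (hprim : ¬ IsPrimitive φ) (hab : a ≠ b)
    (hφa : φ (FreeMonoid.of a) ≠ FreeMonoid.of a) (hwa : w 0 = a) (hwb : ∃ n, w n = b)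
    (hmin : IsMinimal w) (haper : Aperiodic w) : HasFormAXA φ a b := by
  have ha1 : φ (FreeMonoid.of a) ≠ 1 := fun h => haper (hw.ultimatelyPeriodic_of_erasing hab h)
  have hb1 : φ (FreeMonoid.of b) ≠ 1 := fun h =>
    haper (hw.ultimatelyPeriodic_of_erasing hab.symm h)
  have hrun : ¬ ∀ N, ∃ i, ∀ t < N, w (i + t) = b := fun h =>
    hab (hwa.symm.trans (hmin.eq_of_forall_exists_run h 0))
  obtain ⟨y, hy⟩ : ∃ y : FreeMonoid (Fin 2), φ (FreeMonoid.of a) = FreeMonoid.of a * y := by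
    have h := hw.map_letter 0
    have hpos := length_pos_of_ne_one ha1
    rw [hwa, imagePos_zero] at h
    obtain ⟨l, hl⟩ := Nat.exists_eq_add_of_lt hpos
    rw [hl, zero_add, add_comm l 1, factor_add, factor_one, hwa] at h
    exact ⟨_, h⟩
  have hy1 : y ≠ 1 := fun h => hφa (by rw [hy, h, mul_one])
  have haa : a ∈ φ (FreeMonoid.of a) := by rw [hy]; simp
  have hba : b ∈ φ (FreeMonoid.of a) := hw.mem_map_of_mem hab hwa hwb hb1 (by
    have := length_pos_of_ne_one hy1
    rw [hy, FreeMonoid.length_mul, FreeMonoid.length_of]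
    omega)
  have hab' : a ∉ φ (FreeMonoid.of b) := fun h => hprim (isPrimitive_of_mem hab haa hba h)
  have hb : φ (FreeMonoid.of b) = FreeMonoid.of b := by
    have hlen : (φ (FreeMonoid.of b)).length = 1 := by
      have := length_pos_of_ne_one hb1
      by_contra hne
      exact hrun (hw.exists_run_of_growing hab hwb hab' (by omega))
    obtain ⟨c, hc⟩ := FreeMonoid.length_eq_one.1 hlen
    rw [hc] at hab' ⊢
    rw [(eq_or_eq_of_ne hab c).resolve_left fun h => hab' (by simp [h])]
  obtain ⟨x, c, rfl⟩ : ∃ (x : FreeMonoid (Fin 2)) (c : Fin 2), y = x * FreeMonoid.of c := by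
    rcases List.eq_nil_or_concat y.toList with h | ⟨x, c, h⟩
    · exact absurd (FreeMonoid.toList.injective h) hy1
    · exact ⟨FreeMonoid.ofList x, c, FreeMonoid.toList.injective (h.trans List.concat_eq_append)⟩
  rcases eq_or_eq_of_ne hab c with rfl | rfl
  · refine ⟨hb, x, ?_, by rw [hy, mul_assoc]⟩
    rw [hy] at hba
    simpa [FreeMonoid.mem_mul, hab.symm] using hba
  · refine absurd (fun N => ?_) hrun
    obtain ⟨i, -, hi⟩ := hw.exists_run_of_getLast hab hwa hb (u := FreeMonoid.of a * x)
      (fun h => by simpa using congrArg FreeMonoid.length h) (by rw [hy, mul_assoc]) N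
    exact ⟨i, hi⟩

end Main

end BinaryMorphism

theorem propositionp
    (φ : FreeMonoid (Fin 2) →* FreeMonoid (Fin 2))
    (hprim : ¬ BinaryMorphism.IsPrimitive φ)
    (a b : Fin 2) (hab : a ≠ b) (hφa : φ (FreeMonoid.of a) ≠ FreeMonoid.of a)
    (w : BinaryMorphism.InfWord (Fin 2)) (hw : BinaryMorphism.IsFixedPoint φ w)
    (hwa : w 0 = a) (hwb : ∃ n, w n = b) :
    (BinaryMorphism.IsMinimal w → BinaryMorphism.Aperiodic w → BinaryMorphism.HasFormAXA φ a b) ∧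
    (BinaryMorphism.HasFormAXA φ a b →
      BinaryMorphism.IsMinimal w ∧ BinaryMorphism.UniquelyErgodic w ∧
      ∃ θ : ℝ, BinaryMorphism.LengthRatioTendsto φ w θ) := by
  refine ⟨hw.hasFormAXA hprim hab hφa hwa hwb, fun h => ?_⟩
  have hblocks := hw.exists_isBlockSet hab hwa h
  obtain ⟨θ, hθ⟩ := BinaryMorphism.exists_hasUniformAverage hblocks
    (f := fun x => ((φ (FreeMonoid.of (x 0))).length : ℝ))
    ((continuous_of_discreteTopology
      (f := fun c => ((φ (FreeMonoid.of c)).length : ℝ))).comp (continuous_apply 0))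
  exact ⟨BinaryMorphism.isMinimal_of_isBlockSet hblocks,
    BinaryMorphism.uniquelyErgodic_of_hasUniformAverage fun _ hf =>
      BinaryMorphism.exists_hasUniformAverage hblocks hf,
    θ, hθ.lengthRatioTendsto⟩
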